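/- **Theorem (initial point reduction).** Let $A\in\mathbb R^{m\times d}$, $b\in\mathbb R^m$, $0\ne c\in\mathbb R^d$, let $\mathcal K\subseteq\mathbb R^d$ be convex, and consider the convex program $\min\{c^\top x: x\in\mathcal K,\ Ax=b\}$ with outer radius $R$, i.e. $\|x\|_2\le R$ for all $x\in\mathcal K$. Let $\mathcal K_{\rm in}\subseteq\mathcal K$ be a convex set with inner radius $r>0$, i.e. there is $z\in\mathbb R^d$ with $Az=b$ and $B(z,r)\subseteq\mathcal K_{\rm in}$. For $s>0$ put $c_1=c$ and $c_2=c_3=\frac{s\|c\|_2}{\sqrt d}\mathbf 1$, write $\bar x=(x^{(1)},x^{(2)},x^{(3)})\in\mathbb R^{3d}$ and $\bar c^\top\bar x=c_1^\top x^{(1)}+c_2^\top x^{(2)}+c_3^\top x^{(3)}$, and let $$\mathcal P=\{\bar x:\ x^{(1)}\in\mathcal K,\ x^{(2)},x^{(3)}\ge 0,\ A(x^{(1)}+x^{(2)}-x^{(3)})=b\},$$ $$\mathcal P_{\rm in}=\{\bar x:\ x^{(1)}\in\mathcal K_{\rm in},\ x^{(2)},x^{(3)}\ge 0,\ A(x^{(1)}+x^{(2)}-x^{(3)})=b\}.$$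 Let $\psi$ be a $\nu$-self-concordant barrier for $\mathcal P_{\rm in}$. That is, $\psi$ is a $C^3$ convex function on the relative interior of $\mathcal P_{\rm in}$ which tends to $+\infty$ at every relative boundary point and satisfies, for every point $x$ of the relative interior and every direction $h$ of the affine span of $\mathcal P_{\rm in}$, $$|D^3\psi(x)[h,h,h]|\le 2\,(D^2\psi(x)[h,h])^{3/2}\quad\text{and}\quad (D\psi(x)[h])^2\le\nu\,D^2\psi(x)[h,h].$$ Let $$t>0,\qquad t>\frac{\nu}{\|c\|_2R},\qquad s\ \ge\ 48\,\nu\, t\,\sqrt d\cdot\frac{R}{r}\cdot\|c\|_2R,$$ let $\bar x_t=(x_t^{(1)},x_t^{(2)},x_t^{(3)})$ be a minimizer of $f_t(\bar x)=t\,\bar c^\top\bar x+\psi(\bar x)$ over the relative interior of $\mathcal P_{\rm in}$, and let $x_{\rm in}=x_t^{(1)}+x_t^{(2)}-x_t^{(3)}$. If $\gamma\in\mathbb R$ satisfies $\inf_{\bar x\in\mathcal P_{\rm in}}\bar c^\top\bar x\le\inf_{\bar x\in\mathcal P}\bar c^\top\bar x+\gamma$, then 1. $Ax_{\rm in}=b$,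 2. $x_{\rm in}\in\mathcal K_{\rm in}$, 3. $c^\top x_{\rm in}\le\inf_{x\in\mathcal K,\,Ax=b}c^\top x+\frac{\nu+1}{t}+\gamma$. -/

import Mathlib

open scoped Matrix Topology

/-- The restriction of `F` to the affine span of `S`, read as a function of the displacement `v`
(a tangent direction of `S`) from the point `x`. -/
def alongSpan {E : Type*} [NormedAddCommGroup E] [NormedSpace ℝ E]
    (S : Set E) (F : E → ℝ) (x : E) : vectorSpan ℝ S → ℝ :=
  fun v => F (x + (v : E))

/-- `F` is a `ν`-self-concordant barrier for the convex set `S`. The set `S` need not be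
full-dimensional: the domain of `F` is the relative interior of `S` (values elsewhere are
irrelevant), and derivatives are taken along the directions of the affine span of `S`.
`barrier_param` is the coordinate-free form of `∇Fᵀ (∇²F)⁻¹ ∇F ≤ ν`; it is equivalent to it when
the Hessian is invertible. -/
structure IsSelfConcordantBarrier {E : Type*} [NormedAddCommGroup E] [NormedSpace ℝ E]
    (S : Set E) (ν : ℝ) (F : E → ℝ) : Prop where
  contDiffAt : ∀ x ∈ intrinsicInterior ℝ S, ContDiffAt ℝ 3 (alongSpan S F x) 0
  hessian_nonneg : ∀ x ∈ intrinsicInterior ℝ S, ∀ h : vectorSpan ℝ S,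
    0 ≤ iteratedFDeriv ℝ 2 (alongSpan S F x) 0 (fun _ => h)
  self_concordant : ∀ x ∈ intrinsicInterior ℝ S, ∀ h : vectorSpan ℝ S,
    |iteratedFDeriv ℝ 3 (alongSpan S F x) 0 (fun _ => h)| ≤
      2 * (iteratedFDeriv ℝ 2 (alongSpan S F x) 0 (fun _ => h)) ^ (3 / 2 : ℝ)
  barrier_param : ∀ x ∈ intrinsicInterior ℝ S, ∀ h : vectorSpan ℝ S,
    (fderiv ℝ (alongSpan S F x) 0 h) ^ 2 ≤
      ν * iteratedFDeriv ℝ 2 (alongSpan S F x) 0 (fun _ => h)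
  tendsto_boundary : ∀ y ∈ intrinsicFrontier ℝ S,
    Filter.Tendsto F (𝓝[intrinsicInterior ℝ S] y) Filter.atTop

/-- The feasible set `{x ∈ K : A x = b}` of the original convex program. -/
def feasibleSet {m d : ℕ} (A : Matrix (Fin m) (Fin d) ℝ) (b : Fin m → ℝ)
    (K : Set (EuclideanSpace ℝ (Fin d))) : Set (EuclideanSpace ℝ (Fin d)) :=
  {x | x ∈ K ∧ A *ᵥ x.ofLp = b}

/-- Triples `(x⁽¹⁾, x⁽²⁾, x⁽³⁾)` of vectors of `ℝᵈ`. -/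
abbrev SlackSpace (d : ℕ) : Type :=
  EuclideanSpace ℝ (Fin d) × EuclideanSpace ℝ (Fin d) × EuclideanSpace ℝ (Fin d)

/-- The point `x⁽¹⁾ + x⁽²⁾ - x⁽³⁾`. -/
def collapse {d : ℕ} (x : SlackSpace d) : EuclideanSpace ℝ (Fin d) :=
  x.1 + x.2.1 - x.2.2

/-- The feasible set of the modified convex program built on `K`:
`x⁽¹⁾ ∈ K`, `x⁽²⁾, x⁽³⁾ ≥ 0`, `A (x⁽¹⁾ + x⁽²⁾ - x⁽³⁾) = b`. -/
def modifiedSet {m d : ℕ} (A : Matrix (Fin m) (Fin d) ℝ) (b : Fin m → ℝ)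
    (K : Set (EuclideanSpace ℝ (Fin d))) : Set (SlackSpace d) :=
  {x | x.1 ∈ K ∧ (∀ i, 0 ≤ x.2.1 i) ∧ (∀ i, 0 ≤ x.2.2 i) ∧ A *ᵥ (collapse x).ofLp = b}

/-- The penalty vector `c₂ = c₃ = (s ‖c‖₂ / √d) • 𝟏`. -/
noncomputable def penaltyVector {d : ℕ} (c : EuclideanSpace ℝ (Fin d)) (s : ℝ) :
    EuclideanSpace ℝ (Fin d) :=
  WithLp.toLp 2 (fun _ => s * ‖c‖ / √(d : ℝ))

/-- The objective `c₁ᵀ x⁽¹⁾ + c₂ᵀ x⁽²⁾ + c₃ᵀ x⁽³⁾` of the modified convex program. -/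
noncomputable def modifiedCost {d : ℕ} (c : EuclideanSpace ℝ (Fin d)) (s : ℝ)
    (x : SlackSpace d) : ℝ :=
  inner ℝ c x.1 + inner ℝ (penaltyVector c s) x.2.1 + inner ℝ (penaltyVector c s) x.2.2

/-! Everything about `ψ` is read off its restrictions to lines. There a barrier's slope is at most
`ν` over the remaining length (`deriv_mul_sub_le`), it cannot blow up within the Dikin radius
(`one_le_mul_of_tendsto`), and a large second derivative makes the slope grow fast
(`growth_le_deriv_sub`).

Optimality of `xt` turns the slope bound into a gap of at most `ν / t` against every point of the
modified set. Comparing with `(z, 0, 0)` and using the large penalty, the slack `u = x⁽²⁾ - x⁽³⁾`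
has norm at most `r / (16νθ)`, where `θ = t‖c‖R`. For membership in `Kin`, aim from `xt` at `(z - u,
x⁽²⁾, x⁽³⁾)`: the slope is at least `-2θ`, so the local norm of this direction is below `16νθ`
(`sqrt_hessian_lt`). By Dikin one may step backwards from `xt` by a fraction of about `1 / (16νθ)`.
Averaging that point with a point of the ball around `z` gives `x⁽¹⁾ + u`. The cost bound holds
because the penalty dominates `cᵀu`. -/

/-! ### Self-concordant functions of one variable. -/

/-- A function of one real variable that satisfies the differential inequalities of a
`ν`-self-concordant barrier at every point of `D`. -/
structure IsSelfConcordantOn (D : Set ℝ) (ν : ℝ) (φ : ℝ → ℝ) : Prop where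
  contDiffAt : ∀ x ∈ D, ContDiffAt ℝ 3 φ x
  nonneg : ∀ x ∈ D, 0 ≤ iteratedDeriv 2 φ x
  self_concordant : ∀ x ∈ D,
    |iteratedDeriv 3 φ x| ≤ 2 * (iteratedDeriv 2 φ x) ^ (3 / 2 : ℝ)
  barrier_param : ∀ x ∈ D, (deriv φ x) ^ 2 ≤ ν * iteratedDeriv 2 φ x

lemma le_of_hasDerivAt_le {f g f' g' : ℝ → ℝ} {a b : ℝ} (hab : a ≤ b)
    (hf : ∀ x ∈ Set.Icc a b, HasDerivAt f (f' x) x)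
    (hg : ∀ x ∈ Set.Icc a b, HasDerivAt g (g' x) x)
    (hle : ∀ x ∈ Set.Icc a b, f' x ≤ g' x) : f b - f a ≤ g b - g a := by
  have hd : ∀ x ∈ Set.Icc a b, HasDerivAt (fun y => g y - f y) (g' x - f' x) x :=
    fun x hx => (hg x hx).sub (hf x hx)
  have hmono : MonotoneOn (fun y => g y - f y) (Set.Icc a b) := by
    refine monotoneOn_of_deriv_nonneg (convex_Icc a b)
      (fun x hx => (hd x hx).continuousAt.continuousWithinAt)
      (fun x hx => (hd x (interior_subset hx)).differentiableAt.differentiableWithinAt) ?_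
    intro x hx
    rw [(hd x (interior_subset hx)).deriv]
    linarith [hle x (interior_subset hx)]
  have := hmono (Set.left_mem_Icc.2 hab) (Set.right_mem_Icc.2 hab) hab
  simp only at this
  linarith

namespace IsSelfConcordantOn

variable {D : Set ℝ} {ν : ℝ} {φ : ℝ → ℝ}

lemma mono (h : IsSelfConcordantOn D ν φ) {D' : Set ℝ} (hD : D' ⊆ D) :
    IsSelfConcordantOn D' ν φ :=
  ⟨fun x hx => h.1 x (hD hx), fun x hx => h.2 x (hD hx), fun x hx => h.3 x (hD hx),
    fun x hx => h.4 x (hD hx)⟩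

lemma hasDerivAt_zero (h : IsSelfConcordantOn D ν φ) {x : ℝ} (hx : x ∈ D) :
    HasDerivAt φ (deriv φ x) x :=
  ((h.contDiffAt x hx).differentiableAt (by norm_num)).hasDerivAt

lemma hasDerivAt_iteratedDeriv (h : IsSelfConcordantOn D ν φ) {x : ℝ} (hx : x ∈ D) {k : ℕ}
    (hk : k < 3) : HasDerivAt (iteratedDeriv k φ) (iteratedDeriv (k + 1) φ x) x := by
  rw [iteratedDeriv_succ]
  refine DifferentiableAt.hasDerivAt ?_
  have := (h.contDiffAt x hx).differentiableAt_iteratedFDeriv (m := k) (by exact_mod_cast hk)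
  rw [iteratedDeriv_eq_equiv_comp]
  exact (LinearIsometryEquiv.differentiableAt _).comp x this

lemma hasDerivAt_deriv (h : IsSelfConcordantOn D ν φ) {x : ℝ} (hx : x ∈ D) :
    HasDerivAt (deriv φ) (iteratedDeriv 2 φ x) x := by
  simpa [iteratedDeriv_one] using h.hasDerivAt_iteratedDeriv hx (k := 1) (by norm_num)

lemma abs_third_le (h : IsSelfConcordantOn D ν φ) {x : ℝ} (hx : x ∈ D) :
    |iteratedDeriv 3 φ x| ≤ 2 * (iteratedDeriv 2 φ x * √(iteratedDeriv 2 φ x)) := by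
  have h1 := h.self_concordant x hx
  have h2 := h.nonneg x hx
  have : (iteratedDeriv 2 φ x) ^ (3 / 2 : ℝ) = iteratedDeriv 2 φ x * √(iteratedDeriv 2 φ x) := by
    rw [Real.sqrt_eq_rpow, show (3 / 2 : ℝ) = 1 + 1 / 2 by norm_num,
      Real.rpow_add_of_nonneg h2 (by norm_num) (by norm_num), Real.rpow_one]
  rwa [this] at h1

lemma abs_deriv_le (h : IsSelfConcordantOn D ν φ) {x : ℝ} (hx : x ∈ D) :
    |deriv φ x| ≤ √ν * √(iteratedDeriv 2 φ x) := by
  rw [← Real.sqrt_mul' _ (h.nonneg x hx)]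
  exact Real.abs_le_sqrt (h.barrier_param x hx)

/-- Along a segment, `(φ'')^(-1/2)` is `1`-Lipschitz, in a form that allows `φ''` to vanish. -/
lemma sqrt_le_sqrt_mul (hD : Convex ℝ D) (h : IsSelfConcordantOn D ν φ) {a b : ℝ} (ha : a ∈ D)
    (hb : b ∈ D) :
    √(iteratedDeriv 2 φ a) ≤
      √(iteratedDeriv 2 φ b) * (1 + |b - a| * √(iteratedDeriv 2 φ a)) := by
  -- Adding `η` keeps the inverse square root differentiable where the second derivative vanishes;
  -- `η → 0` at the end.
  have key : ∀ η : ℝ, 0 < η → √(iteratedDeriv 2 φ a + η) ≤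
      √(iteratedDeriv 2 φ b + η) * (1 + |b - a| * √(iteratedDeriv 2 φ a + η)) := by
    intro η hη
    have hpos : ∀ x ∈ D, 0 < √(iteratedDeriv 2 φ x + η) := fun x hx =>
      Real.sqrt_pos.2 (by linarith [h.nonneg x hx])
    have hd : ∀ x ∈ D, HasDerivWithinAt (fun y => (√(iteratedDeriv 2 φ y + η))⁻¹)
        (-(iteratedDeriv 3 φ x / (2 * √(iteratedDeriv 2 φ x + η))) /
          √(iteratedDeriv 2 φ x + η) ^ 2) D x := by
      intro x hx
      have h1 := (h.hasDerivAt_iteratedDeriv hx (k := 2) (by norm_num)).add_const η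
      have h2 := h1.sqrt (by linarith [h.nonneg x hx])
      exact (h2.fun_inv (hpos x hx).ne').hasDerivWithinAt
    have hb' : ∀ x ∈ D, ‖-(iteratedDeriv 3 φ x / (2 * √(iteratedDeriv 2 φ x + η))) /
          √(iteratedDeriv 2 φ x + η) ^ 2‖ ≤ 1 := by
      intro x hx
      have hp := hpos x hx
      have h3 := h.abs_third_le hx
      have hn := h.nonneg x hx
      rw [norm_div, norm_neg, norm_div, Real.norm_eq_abs, Real.norm_eq_abs, Real.norm_eq_abs,
        abs_of_pos (by positivity : 0 < 2 * √(iteratedDeriv 2 φ x + η)),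
        abs_of_pos (by positivity : 0 < √(iteratedDeriv 2 φ x + η) ^ 2), div_div,
        div_le_one (by positivity)]
      refine h3.trans ?_
      rw [mul_assoc 2, mul_comm (√(iteratedDeriv 2 φ x + η)) (_ ^ 2),
        Real.sq_sqrt (by linarith)]
      gcongr <;> linarith
    have hL := hD.norm_image_sub_le_of_norm_hasDerivWithin_le hd hb' ha hb
    rw [one_mul, Real.norm_eq_abs, Real.norm_eq_abs] at hL
    have h1 := (abs_le.1 hL).2
    have hpa := hpos a ha
    have hpb := hpos b hb
    have h2 : (√(iteratedDeriv 2 φ b + η))⁻¹ ≤ (√(iteratedDeriv 2 φ a + η))⁻¹ + |b - a| := by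
      linarith
    have h3 := mul_le_mul_of_nonneg_left h2 (mul_pos hpa hpb).le
    have e1 : √(iteratedDeriv 2 φ a + η) * √(iteratedDeriv 2 φ b + η) *
        (√(iteratedDeriv 2 φ b + η))⁻¹ = √(iteratedDeriv 2 φ a + η) := by field_simp
    have e2 : √(iteratedDeriv 2 φ a + η) * √(iteratedDeriv 2 φ b + η) *
        ((√(iteratedDeriv 2 φ a + η))⁻¹ + |b - a|) =
        √(iteratedDeriv 2 φ b + η) * (1 + |b - a| * √(iteratedDeriv 2 φ a + η)) := by
      field_simp
    rwa [e1, e2] at h3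
  have hl : Filter.Tendsto (fun η : ℝ => √(iteratedDeriv 2 φ a + η)) (𝓝[>] 0)
      (𝓝 √(iteratedDeriv 2 φ a)) := by
    have : Continuous (fun η : ℝ => √(iteratedDeriv 2 φ a + η)) := by fun_prop
    simpa using (this.tendsto 0).mono_left nhdsWithin_le_nhds
  have hr : Filter.Tendsto (fun η : ℝ => √(iteratedDeriv 2 φ b + η) *
      (1 + |b - a| * √(iteratedDeriv 2 φ a + η))) (𝓝[>] 0)
      (𝓝 (√(iteratedDeriv 2 φ b) * (1 + |b - a| * √(iteratedDeriv 2 φ a)))) := by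
    have : Continuous (fun η : ℝ => √(iteratedDeriv 2 φ b + η) *
      (1 + |b - a| * √(iteratedDeriv 2 φ a + η))) := by fun_prop
    simpa using (this.tendsto 0).mono_left nhdsWithin_le_nhds
  exact le_of_tendsto_of_tendsto hl hr (eventually_mem_nhdsWithin.mono key)

/-- The derivative of a self-concordant function grows at least as fast as that of the logarithmic
barrier with the same second derivative. -/
lemma growth_le_deriv_sub {a b : ℝ} (hab : a ≤ b) (h : IsSelfConcordantOn (Set.Icc a b) ν φ) :
    iteratedDeriv 2 φ a * (b - a) / (1 + √(iteratedDeriv 2 φ a) * (b - a)) ≤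
      deriv φ b - deriv φ a := by
  set q := √(iteratedDeriv 2 φ a) with hq
  have hq0 : 0 ≤ q := Real.sqrt_nonneg _
  have hqq : iteratedDeriv 2 φ a = q ^ 2 :=
    (Real.sq_sqrt (h.nonneg a (Set.left_mem_Icc.2 hab))).symm
  have hpos : ∀ x ∈ Set.Icc a b, 0 < 1 + q * (x - a) := by
    intro x hx
    have := mul_nonneg hq0 (sub_nonneg.2 hx.1)
    linarith
  -- The Lipschitz bound gives `φ'' ≥ (q / (1 + q (x - a)))²`, and `f` is the primitive of the right
  -- side vanishing at `a`.
  have := le_of_hasDerivAt_le (f := fun x => q ^ 2 * (x - a) / (1 + q * (x - a)))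
    (f' := fun x => q ^ 2 / (1 + q * (x - a)) ^ 2) hab ?_ (fun x hx => h.hasDerivAt_deriv hx) ?_
  · simpa [hqq] using this
  · intro x hx
    have h1 : HasDerivAt (fun x => x - a) 1 x := (hasDerivAt_id x).sub_const a
    have h2 := (h1.const_mul (q ^ 2)).fun_div ((h1.const_mul q).const_add 1) (hpos x hx).ne'
    refine h2.congr_deriv ?_
    congr 1
    ring
  · intro x hx
    have hp := hpos x hx
    have h1 := h.sqrt_le_sqrt_mul (convex_Icc a b) (Set.left_mem_Icc.2 hab) hx
    rw [← hq, abs_of_nonneg (sub_nonneg.2 hx.1)] at h1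
    rw [← div_pow, ← Real.sq_sqrt (h.nonneg x hx)]
    gcongr
    rw [div_le_iff₀ hp]
    linarith

/-- While `φ' > 0`, the barrier inequality says that `-1/φ'` has derivative at least `1/ν`. It stays
negative up to `b`, so `(b - a)/ν ≤ 1/φ'(a)`. -/
lemma deriv_mul_sub_le {a b : ℝ} (hab : a ≤ b) (hν : 0 ≤ ν)
    (h : IsSelfConcordantOn (Set.Icc a b) ν φ) : deriv φ a * (b - a) ≤ ν := by
  rcases le_or_gt (deriv φ a) 0 with hw | hw
  · nlinarith
  have hmono : ∀ x ∈ Set.Icc a b, 0 < deriv φ x := by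
    intro x hx
    have hs : Set.Icc a x ⊆ Set.Icc a b := Set.Icc_subset_Icc_right hx.2
    have := le_of_hasDerivAt_le (f := fun _ => 0) (f' := fun _ => 0) hx.1
      (fun y _ => hasDerivAt_const y 0) (fun y hy => h.hasDerivAt_deriv (hs hy))
      (fun y hy => h.nonneg y (hs hy))
    linarith
  have hb := hmono b (Set.right_mem_Icc.2 hab)
  rcases hν.eq_or_lt with rfl | hν
  · have := h.barrier_param a (Set.left_mem_Icc.2 hab)
    nlinarith
  have := le_of_hasDerivAt_le (f := fun x => ν⁻¹ * x) (f' := fun _ => ν⁻¹ * 1)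
    (g := fun x => -(deriv φ x)⁻¹)
    (g' := fun x => -(-iteratedDeriv 2 φ x / deriv φ x ^ 2)) hab
    (fun x _ => (hasDerivAt_id x).const_mul _)
    (fun x hx => ((h.hasDerivAt_deriv hx).fun_inv (hmono x hx).ne').neg) ?_
  · have h1 : ν⁻¹ * (b - a) ≤ (deriv φ a)⁻¹ := by
      have := inv_pos.2 hb
      linarith
    calc deriv φ a * (b - a) = deriv φ a * ν * (ν⁻¹ * (b - a)) := by field_simp
      _ ≤ deriv φ a * ν * (deriv φ a)⁻¹ := by gcongr
      _ = ν := by field_simp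
  · intro x hx
    have hp := hmono x hx
    rw [neg_div, neg_neg, mul_one, inv_eq_one_div, div_le_div_iff₀ hν (by positivity)]
    linarith [h.barrier_param x hx]

/-- A barrier that blows up in finite time has parameter at least one. -/
lemma one_le_of_tendsto {T : ℝ} (hT : 0 < T) (h : IsSelfConcordantOn (Set.Ico 0 T) ν φ)
    (hlim : Filter.Tendsto φ (𝓝[<] T) Filter.atTop) : 1 ≤ ν := by
  by_contra hν
  push Not at hν
  have hev : ∀ᶠ x in 𝓝[<] T, x ∈ Set.Ioo 0 T := Ioo_mem_nhdsLT hT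
  obtain ⟨a, ha, haD⟩ : ∃ a ∈ Set.Ioo 0 T, 0 < deriv φ a := by
    by_contra! hcon
    obtain ⟨x, hx1, hx2⟩ := ((hlim.eventually_gt_atTop (φ (T / 2))).and
      (Ioo_mem_nhdsLT (show T / 2 < T by linarith) :
        ∀ᶠ x in 𝓝[<] T, x ∈ Set.Ioo (T / 2) T)).exists
    have hs : ∀ y ∈ Set.Icc (T / 2) x, y ∈ Set.Ioo 0 T := fun y hy =>
      ⟨by linarith [hy.1], by linarith [hy.2, hx2.2]⟩
    have := le_of_hasDerivAt_le (g := fun _ => 0) (g' := fun _ => 0) hx2.1.le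
      (fun y hy => h.hasDerivAt_zero (Set.Ioo_subset_Ico_self (hs y hy)))
      (fun y _ => hasDerivAt_const y 0) (fun y hy => hcon y (hs y hy))
    linarith
  have hsub : ∀ {x}, x < T → Set.Icc a x ⊆ Set.Ico 0 T := fun hx y hy =>
    ⟨by linarith [hy.1, ha.1], by linarith [hy.2]⟩
  have hmono : ∀ x ∈ Set.Ico a T, 0 < deriv φ x := by
    intro x hx
    have := le_of_hasDerivAt_le (f := fun _ => 0) (f' := fun _ => 0) hx.1
      (fun y _ => hasDerivAt_const y 0) (fun y hy => h.hasDerivAt_deriv (hsub hx.2 hy))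
      (fun y hy => h.nonneg y (hsub hx.2 hy))
    linarith
  have hν0 : 0 < ν := by
    have h1 := h.barrier_param a ⟨ha.1.le, ha.2⟩
    have h2 := h.nonneg a ⟨ha.1.le, ha.2⟩
    by_contra! hcon
    nlinarith
  have hsν : √ν < 1 := by rw [Real.sqrt_lt' one_pos]; simpa using hν
  have hsν0 : 0 < √ν := Real.sqrt_pos.2 hν0
  have hκ : 0 < (√ν)⁻¹ - 1 := sub_pos.2 ((one_lt_inv₀ hsν0).2 hsν)
  have hgpos : ∀ x ∈ Set.Ico a T, 0 < iteratedDeriv 2 φ x := by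
    intro x hx
    have h1 := h.barrier_param x ⟨by linarith [hx.1, ha.1], hx.2⟩
    have h2 := hmono x hx
    by_contra! hcon
    nlinarith [mul_nonneg hν0.le (neg_nonneg.2 hcon)]
  -- The quotient `φ'/√φ''` is at most `√ν`, while its derivative is at least `√φ'' - φ' ≥ (1/√ν -
  -- 1) φ'`. For `ν < 1` integration bounds `φ`, contradicting the blow-up.
  have hbound : ∀ x ∈ Set.Ico a T, φ x ≤ √ν / ((√ν)⁻¹ - 1) + φ a := by
    intro x hx
    have hin : ∀ y ∈ Set.Icc a x, y ∈ Set.Ico a T := fun y hy => ⟨hy.1, by linarith [hy.2, hx.2]⟩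
    have := le_of_hasDerivAt_le (f := fun y => ((√ν)⁻¹ - 1) * φ y)
      (g := fun y => deriv φ y / √(iteratedDeriv 2 φ y)) hx.1
      (fun y hy => (h.hasDerivAt_zero (hsub hx.2 hy)).const_mul _)
      (fun y hy => (h.hasDerivAt_deriv (hsub hx.2 hy)).fun_div
        ((h.hasDerivAt_iteratedDeriv (hsub hx.2 hy) (k := 2) (by norm_num)).sqrt
          (hgpos y (hin y hy)).ne') (Real.sqrt_pos.2 (hgpos y (hin y hy))).ne') ?_
    · have h1 := h.abs_deriv_le (hsub hx.2 (Set.right_mem_Icc.2 hx.1))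
      have h2 : deriv φ x / √(iteratedDeriv 2 φ x) ≤ √ν := by
        rw [div_le_iff₀ (Real.sqrt_pos.2 (hgpos x hx))]
        exact (le_abs_self _).trans h1
      have h3 : 0 ≤ deriv φ a / √(iteratedDeriv 2 φ a) := by positivity
      rw [← sub_le_iff_le_add, le_div_iff₀ hκ]
      linarith
    · intro y hy
      have hy' := hsub hx.2 hy
      have hw := hmono y (hin y hy)
      have hp := Real.sqrt_pos.2 (hgpos y (hin y hy))
      have h1 := h.abs_deriv_le hy'
      have h3 := (abs_le.1 (h.abs_third_le hy')).2
      have hsq := Real.sq_sqrt (h.nonneg y hy')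
      rw [abs_of_pos hw] at h1
      set q := √(iteratedDeriv 2 φ y)
      rw [← hsq] at h3 ⊢
      have h4 : deriv φ y * (iteratedDeriv (2 + 1) φ y / (2 * q)) ≤ deriv φ y * q ^ 2 := by
        gcongr
        rw [div_le_iff₀ (by positivity)]
        nlinarith
      rw [le_div_iff₀ (by positivity)]
      have h5 : (√ν)⁻¹ * deriv φ y ≤ q := by
        rw [inv_mul_le_iff₀ hsν0]; exact h1
      nlinarith [mul_le_mul_of_nonneg_right h5 (sq_nonneg q)]
  obtain ⟨x, hx1, hx2⟩ := ((hlim.eventually_gt_atTop (√ν / ((√ν)⁻¹ - 1) + φ a)).and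
      (Ioo_mem_nhdsLT ha.2 : ∀ᶠ x in 𝓝[<] T, x ∈ Set.Ioo a T)).exists
  exact absurd (hbound x ⟨hx2.1.le, hx2.2⟩) (not_le.2 hx1)

/-- The Dikin bound: a self-concordant function cannot blow up within distance `φ''(0)^(-1/2)`. -/
lemma one_le_mul_of_tendsto {T : ℝ} (hT : 0 < T) (h : IsSelfConcordantOn (Set.Ico 0 T) ν φ)
    (hlim : Filter.Tendsto φ (𝓝[<] T) Filter.atTop) : 1 ≤ T * √(iteratedDeriv 2 φ 0) := by
  by_contra hq
  push Not at hq
  set q := √(iteratedDeriv 2 φ 0) with hqdef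
  have hq0 : 0 ≤ q := Real.sqrt_nonneg _
  set M := (q / (1 - T * q)) ^ 2 with hM
  have hM0 : 0 ≤ M := sq_nonneg _
  have h0 : (0 : ℝ) ∈ Set.Ico 0 T := ⟨le_rfl, hT⟩
  -- If `T q < 1`, the Lipschitz bound keeps `φ''` bounded up to `T`; two integrations then bound
  -- `φ`.
  have hg : ∀ x ∈ Set.Ico 0 T, iteratedDeriv 2 φ x ≤ M := by
    intro x hx
    have h1 := h.sqrt_le_sqrt_mul (convex_Ico 0 T) hx h0
    rw [← hqdef, zero_sub, abs_neg, abs_of_nonneg hx.1] at h1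
    rw [← Real.sq_sqrt (h.nonneg x hx), hM]
    gcongr
    rw [le_div_iff₀ (by linarith)]
    have h2 : x * (q * √(iteratedDeriv 2 φ x)) ≤ T * (q * √(iteratedDeriv 2 φ x)) := by
      gcongr; exact hx.2.le
    nlinarith
  have hsub : ∀ {x}, x < T → Set.Icc 0 x ⊆ Set.Ico 0 T := fun hx y hy =>
    ⟨hy.1, by linarith [hy.2]⟩
  have hd : ∀ x ∈ Set.Ico 0 T, deriv φ x ≤ |deriv φ 0| + M * T := by
    intro x hx
    have := le_of_hasDerivAt_le (g := fun x => M * x) (g' := fun _ => M * 1) hx.1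
      (fun y hy => h.hasDerivAt_deriv (hsub hx.2 hy))
      (fun y _ => (hasDerivAt_id y).const_mul _)
      (fun y hy => by simpa using hg y (hsub hx.2 hy))
    have h2 : M * x ≤ M * T := by gcongr; exact hx.2.le
    linarith [le_abs_self (deriv φ 0)]
  have hb : ∀ x ∈ Set.Ico 0 T, φ x ≤ φ 0 + (|deriv φ 0| + M * T) * T := by
    intro x hx
    have := le_of_hasDerivAt_le (g := fun x => (|deriv φ 0| + M * T) * x)
      (g' := fun _ => (|deriv φ 0| + M * T) * 1) hx.1
      (fun y hy => h.hasDerivAt_zero (hsub hx.2 hy))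
      (fun y _ => (hasDerivAt_id y).const_mul _)
      (fun y hy => by simpa using hd y (hsub hx.2 hy))
    have h2 : (|deriv φ 0| + M * T) * x ≤ (|deriv φ 0| + M * T) * T := by
      gcongr; exact hx.2.le
    linarith
  obtain ⟨x, hx1, hx2⟩ := ((hlim.eventually_gt_atTop (φ 0 + (|deriv φ 0| + M * T) * T)).and
      (Ioo_mem_nhdsLT hT : ∀ᶠ x in 𝓝[<] T, x ∈ Set.Ioo 0 T)).exists
  exact absurd (hb x ⟨hx2.1.le, hx2.2⟩) (not_le.2 hx1)

end IsSelfConcordantOn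

/-! ### Restriction to lines and the relative interior. -/

section Line

variable {E : Type*} [NormedAddCommGroup E] [NormedSpace ℝ E]

/-- The map `σ ↦ σ • h` is linear. Since `f` is smooth only near `0`, the chain rule is applied on
an open neighbourhood. -/
lemma iteratedDeriv_comp_smul_zero {f : E → ℝ} {n : ℕ} (hf : ContDiffAt ℝ n f 0) (h : E) :
    iteratedDeriv n (fun σ : ℝ => f (σ • h)) 0 = iteratedFDeriv ℝ n f 0 (fun _ => h) := by
  obtain ⟨u, hu, h0, hfu⟩ := hf.contDiffWithinAt (s := Set.univ) |>.contDiffOn' le_rfl (by simp)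
  rw [Set.insert_eq_of_mem (Set.mem_univ _), Set.univ_inter] at hfu
  let g : ℝ →L[ℝ] E := ContinuousLinearMap.toSpanSingleton ℝ h
  have hg : IsOpen (g ⁻¹' u) := hu.preimage g.continuous
  have hg0 : g 0 ∈ u := by simpa using h0
  have := g.iteratedFDerivWithin_comp_right hfu hu.uniqueDiffOn hg.uniqueDiffOn hg0 le_rfl
  rw [iteratedFDerivWithin_of_isOpen n hu hg0, iteratedFDerivWithin_of_isOpen n hg hg0] at this
  change iteratedDeriv n (f ∘ g) 0 = _
  rw [iteratedDeriv_eq_iteratedFDeriv, this]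
  simp [g]

lemma mem_intrinsicInterior_iff_exists_ball {S : Set E} {x : E} :
    x ∈ intrinsicInterior ℝ S ↔
      x ∈ S ∧ ∃ ε > 0, ∀ v ∈ vectorSpan ℝ S, ‖v‖ < ε → x + v ∈ S := by
  constructor
  · intro hx
    refine ⟨intrinsicInterior_subset hx, ?_⟩
    obtain ⟨y, hy, rfl⟩ := mem_intrinsicInterior.1 hx
    obtain ⟨ε, hε, hball⟩ := Metric.mem_nhds_iff.1 (mem_interior_iff_mem_nhds.1 hy)
    refine ⟨ε, hε, fun v hv hvε => ?_⟩
    have hmem : (y : E) + v ∈ affineSpan ℝ S := by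
      rw [add_comm]
      exact AffineSubspace.vadd_mem_of_mem_direction (by rwa [direction_affineSpan]) y.2
    exact hball (show (⟨y + v, hmem⟩ : affineSpan ℝ S) ∈ Metric.ball y ε by
      rw [Metric.mem_ball, Subtype.dist_eq, dist_eq_norm]; simpa using hvε)
  · rintro ⟨hx, ε, hε, hball⟩
    refine mem_intrinsicInterior.2 ⟨⟨x, subset_affineSpan ℝ S hx⟩, ?_, rfl⟩
    refine mem_interior_iff_mem_nhds.2 (Metric.mem_nhds_iff.2 ⟨ε, hε, fun y hy => ?_⟩)
    have hv : (y : E) - x ∈ vectorSpan ℝ S := by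
      rw [← direction_affineSpan]
      exact AffineSubspace.vsub_mem_direction y.2 (subset_affineSpan ℝ S hx)
    have := hball _ hv (by rwa [Metric.mem_ball, Subtype.dist_eq, dist_eq_norm] at hy)
    simpa using this

lemma isOpen_setOf_add_smul_mem_intrinsicInterior {S : Set E} {x h : E} (hx : x ∈ S)
    (hh : h ∈ vectorSpan ℝ S) : IsOpen {τ : ℝ | x + τ • h ∈ intrinsicInterior ℝ S} := by
  have hmem : ∀ τ : ℝ, x + τ • h ∈ affineSpan ℝ S := by
    intro τ
    rw [add_comm]
    refine AffineSubspace.vadd_mem_of_mem_direction ?_ (subset_affineSpan ℝ S hx)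
    rw [direction_affineSpan]
    exact Submodule.smul_mem _ _ hh
  have hc : Continuous (fun τ : ℝ => (⟨x + τ • h, hmem τ⟩ : affineSpan ℝ S)) := by fun_prop
  convert (isOpen_interior (s := ((↑) ⁻¹' S : Set (affineSpan ℝ S)))).preimage hc using 1
  ext τ
  simp [mem_intrinsicInterior, hmem]

/-- The relative ball around `x`, shrunk by `1 - τ` towards `y`, still lies in `S`. -/
lemma Convex.add_smul_sub_mem_intrinsicInterior {S : Set E} (hS : Convex ℝ S) {x y : E}
    (hx : x ∈ intrinsicInterior ℝ S) (hy : y ∈ S) {τ : ℝ} (h0 : 0 ≤ τ) (h1 : τ < 1) :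
    x + τ • (y - x) ∈ intrinsicInterior ℝ S := by
  obtain ⟨hxS, ε, hε, hball⟩ := mem_intrinsicInterior_iff_exists_ball.1 hx
  have hτ : 0 < 1 - τ := by linarith
  refine mem_intrinsicInterior_iff_exists_ball.2
    ⟨hS.add_smul_sub_mem hxS hy ⟨h0, h1.le⟩, (1 - τ) * ε, by positivity, fun v hv hvε => ?_⟩
  have hw : x + (1 - τ)⁻¹ • v ∈ S := by
    refine hball _ (Submodule.smul_mem _ _ hv) ?_
    rw [norm_smul, norm_inv, Real.norm_of_nonneg hτ.le, inv_mul_lt_iff₀ hτ]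
    exact hvε
  have := hS hw hy hτ.le h0 (by ring)
  rw [smul_add, smul_inv_smul₀ hτ.ne'] at this
  convert this using 1
  module

/-- A ray that leaves the relative interior meets the relative boundary at its first exit time. -/
lemma exists_exit_time {S : Set E} {x h : E} (hx : x ∈ intrinsicInterior ℝ S)
    (hh : h ∈ vectorSpan ℝ S) {τ₁ : ℝ} (hτ₁ : 0 ≤ τ₁)
    (hout : x + τ₁ • h ∉ intrinsicInterior ℝ S) :
    ∃ T, 0 < T ∧ T ≤ τ₁ ∧ (∀ τ ∈ Set.Ico 0 T, x + τ • h ∈ intrinsicInterior ℝ S) ∧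
      x + T • h ∈ intrinsicFrontier ℝ S := by
  have hxS := intrinsicInterior_subset hx
  have hopen := isOpen_setOf_add_smul_mem_intrinsicInterior hxS hh
  set B : Set ℝ := Set.Ici 0 ∩ {τ : ℝ | x + τ • h ∈ intrinsicInterior ℝ S}ᶜ with hB
  have hBc : IsClosed B := isClosed_Ici.inter hopen.isClosed_compl
  have hBb : BddBelow B := ⟨0, fun y hy => hy.1⟩
  have hτB : τ₁ ∈ B := ⟨hτ₁, hout⟩
  have hTB : sInf B ∈ B := hBc.csInf_mem ⟨_, hτB⟩ hBb
  have hlt : ∀ τ ∈ Set.Ico 0 (sInf B), x + τ • h ∈ intrinsicInterior ℝ S := by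
    intro τ hτ
    by_contra hcon
    exact absurd (csInf_le hBb (show τ ∈ B from ⟨hτ.1, hcon⟩)) (not_le.2 hτ.2)
  have hT0 : 0 < sInf B := by
    refine lt_of_le_of_ne hTB.1 fun h0 => hTB.2 ?_
    simpa [← h0] using hx
  refine ⟨sInf B, hT0, csInf_le hBb hτB, hlt, ?_⟩
  rw [← intrinsicClosure_sdiff_intrinsicInterior]
  refine ⟨?_, hTB.2⟩
  rw [intrinsicClosure_eq_closure_inter_affineSpan]
  constructor
  · have hc : Continuous (fun τ : ℝ => x + τ • h) := by fun_prop
    refine mem_closure_of_tendsto ((hc.tendsto (sInf B)).mono_left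
      (nhdsWithin_le_nhds (s := Set.Iio (sInf B)))) ?_
    filter_upwards [Ioo_mem_nhdsLT hT0] with τ hτ
    exact intrinsicInterior_subset (hlt τ ⟨hτ.1.le, hτ.2⟩)
  · rw [add_comm]
    refine AffineSubspace.vadd_mem_of_mem_direction ?_ (subset_affineSpan ℝ S hxS)
    rw [direction_affineSpan]
    exact Submodule.smul_mem _ _ hh

/-! ### Barriers along rays and segments. -/

namespace IsSelfConcordantBarrier

variable {S : Set E} {ν : ℝ} {F : E → ℝ}

lemma isSelfConcordantOn (hF : IsSelfConcordantBarrier S ν F) {x h : E}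
    (hh : h ∈ vectorSpan ℝ S) :
    IsSelfConcordantOn {τ : ℝ | x + τ • h ∈ intrinsicInterior ℝ S} ν (fun τ => F (x + τ • h)) := by
  set φ : ℝ → ℝ := fun τ => F (x + τ • h) with hφ
  set v : vectorSpan ℝ S := ⟨h, hh⟩
  -- The barrier conditions concern displacement `0` from a base point, so the line is recentred at
  -- each `τ`.
  have hshift : ∀ τ : ℝ,
      φ = fun σ => (fun ρ : ℝ => alongSpan S F (x + τ • h) (ρ • v)) (-τ + σ) := by
    intro τ
    ext σ
    simp only [hφ, alongSpan, Submodule.coe_smul, v]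
    congr 1
    module
  have hn : ∀ τ : ℝ, ∀ n : ℕ, n ≤ 3 → x + τ • h ∈ intrinsicInterior ℝ S →
      iteratedDeriv n φ τ = iteratedFDeriv ℝ n (alongSpan S F (x + τ • h)) 0 (fun _ => v) := by
    intro τ n hn3 hτ
    rw [hshift τ, iteratedDeriv_comp_const_add n
      (fun ρ : ℝ => alongSpan S F (x + τ • h) (ρ • v)) (-τ)]
    simp only [neg_add_cancel]
    exact iteratedDeriv_comp_smul_zero ((hF.contDiffAt _ hτ).of_le (by exact_mod_cast hn3)) v
  refine ⟨fun τ hτ => ?_, fun τ hτ => ?_, fun τ hτ => ?_, fun τ hτ => ?_⟩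
  · rw [hshift τ]
    have h1 : ContDiff ℝ 3 (fun σ : ℝ => (-τ + σ) • v) := by fun_prop
    refine ContDiffAt.comp τ (g := alongSpan S F (x + τ • h)) ?_ h1.contDiffAt
    simpa using hF.contDiffAt _ hτ
  · rw [hn τ 2 (by norm_num) hτ]
    exact hF.hessian_nonneg _ hτ v
  · rw [hn τ 2 (by norm_num) hτ, hn τ 3 le_rfl hτ]
    exact hF.self_concordant _ hτ v
  · rw [hn τ 2 (by norm_num) hτ, ← iteratedDeriv_one, hn τ 1 (by norm_num) hτ,
      iteratedFDeriv_one_apply]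
    exact hF.barrier_param _ hτ v

lemma tendsto_exit (hF : IsSelfConcordantBarrier S ν F) {x h : E} {T : ℝ} (hT0 : 0 < T)
    (hin : ∀ τ ∈ Set.Ico 0 T, x + τ • h ∈ intrinsicInterior ℝ S)
    (hT : x + T • h ∈ intrinsicFrontier ℝ S) :
    Filter.Tendsto (fun τ : ℝ => F (x + τ • h)) (𝓝[<] T) Filter.atTop := by
  refine (hF.tendsto_boundary _ hT).comp (tendsto_nhdsWithin_iff.2 ⟨?_, ?_⟩)
  · have hc : Continuous (fun τ : ℝ => x + τ • h) := by fun_prop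
    exact (hc.tendsto T).mono_left nhdsWithin_le_nhds
  · filter_upwards [Ioo_mem_nhdsLT hT0] with τ hτ
    exact hin τ ⟨hτ.1.le, hτ.2⟩

/-- The parameter of a barrier is at least one as soon as some ray leaves the relative interior. -/
lemma one_le_param (hF : IsSelfConcordantBarrier S ν F) {x h : E}
    (hx : x ∈ intrinsicInterior ℝ S) (hh : h ∈ vectorSpan ℝ S) {τ₁ : ℝ} (hτ₁ : 0 ≤ τ₁)
    (hout : x + τ₁ • h ∉ intrinsicInterior ℝ S) : 1 ≤ ν := by
  obtain ⟨T, hT0, -, hin, hT⟩ := exists_exit_time hx hh hτ₁ hout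
  exact ((hF.isSelfConcordantOn hh).mono hin).one_le_of_tendsto hT0 (hF.tendsto_exit hT0 hin hT)

/-- The Dikin ellipsoid of a barrier, along a ray. -/
lemma add_smul_mem_of_mul_sqrt_lt_one (hF : IsSelfConcordantBarrier S ν F) {x h : E}
    (hx : x ∈ intrinsicInterior ℝ S) (hh : h ∈ vectorSpan ℝ S) {δ : ℝ} (hδ : 0 ≤ δ)
    (hq : δ * √(iteratedDeriv 2 (fun τ : ℝ => F (x + τ • h)) 0) < 1) :
    x + δ • h ∈ intrinsicInterior ℝ S := by
  by_contra hout
  obtain ⟨T, hT0, hTδ, hin, hT⟩ := exists_exit_time hx hh hδ hout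
  have h1 := ((hF.isSelfConcordantOn hh).mono hin).one_le_mul_of_tendsto hT0
    (hF.tendsto_exit hT0 hin hT)
  have h2 := mul_le_mul_of_nonneg_right hTδ
    (Real.sqrt_nonneg (iteratedDeriv 2 (fun τ : ℝ => F (x + τ • h)) 0))
  linarith

lemma isSelfConcordantOn_Icc (hF : IsSelfConcordantBarrier S ν F) (hS : Convex ℝ S) {x y : E}
    (hx : x ∈ intrinsicInterior ℝ S) (hy : y ∈ S) {a b : ℝ} (ha : 0 ≤ a) (hb : b < 1) :
    IsSelfConcordantOn (Set.Icc a b) ν (fun τ => F (x + τ • (y - x))) :=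
  (hF.isSelfConcordantOn (vsub_mem_vectorSpan ℝ hy (intrinsicInterior_subset hx))).mono
    fun _ hτ => hS.add_smul_sub_mem_intrinsicInterior hx hy (ha.trans hτ.1) (hτ.2.trans_lt hb)

/-- The slope of a barrier along a segment that stays in the set. -/
lemma deriv_mul_le (hF : IsSelfConcordantBarrier S ν F) (hS : Convex ℝ S) (hν : 0 ≤ ν) {x y : E}
    (hx : x ∈ intrinsicInterior ℝ S) (hy : y ∈ S) {τ : ℝ} (h0 : 0 ≤ τ) (h1 : τ < 1) :
    deriv (fun τ : ℝ => F (x + τ • (y - x))) τ * (1 - τ) ≤ ν := by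
  -- The endpoint `y` may be a boundary point, so the bound is taken up to `b < 1` and `b → 1`.
  have hlim : Filter.Tendsto
      (fun b : ℝ => deriv (fun τ : ℝ => F (x + τ • (y - x))) τ * (b - τ)) (𝓝[<] 1)
      (𝓝 (deriv (fun τ : ℝ => F (x + τ • (y - x))) τ * (1 - τ))) := by
    refine Filter.Tendsto.mono_left (Continuous.tendsto ?_ 1) nhdsWithin_le_nhds
    fun_prop
  refine le_of_tendsto hlim ?_
  filter_upwards [Ioo_mem_nhdsLT h1] with b hb
  exact (hF.isSelfConcordantOn_Icc hS hx hy h0 hb.2).deriv_mul_sub_le hb.1.le hν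

/-- The length of a chord in the local norm, in terms of the slope along it. -/
lemma sqrt_hessian_lt (hF : IsSelfConcordantBarrier S ν F) (hS : Convex ℝ S) (hν : 1 ≤ ν)
    {x y : E} (hx : x ∈ intrinsicInterior ℝ S) (hy : y ∈ S) {θ : ℝ} (hθ : ν < θ)
    (hslope : -(2 * θ) ≤ deriv (fun τ : ℝ => F (x + τ • (y - x))) 0) :
    √(iteratedDeriv 2 (fun τ : ℝ => F (x + τ • (y - x))) 0) < 16 * ν * θ := by
  set φ : ℝ → ℝ := fun τ => F (x + τ • (y - x)) with hφ
  -- At the midpoint the slope is at most `2ν`, so it grows by at most `2ν + 2θ < 4θ` on `[0, 1/2]`.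
  -- A local norm `q ≥ 16νθ ≥ 16θ` would force more growth.
  have h2 := hF.isSelfConcordantOn_Icc hS hx hy le_rfl (show (1 / 2 : ℝ) < 1 by norm_num)
  have h3 := h2.growth_le_deriv_sub (by norm_num)
  have h4 := hF.deriv_mul_le hS (by linarith) hx hy (τ := 1 / 2) (by norm_num) (by norm_num)
  rw [← hφ] at h3 h4
  rw [← Real.sq_sqrt (h2.nonneg 0 (by norm_num)), Real.sqrt_sq (Real.sqrt_nonneg _)] at h3
  set q := √(iteratedDeriv 2 φ 0)
  by_contra! hcon
  have hνθ : θ ≤ ν * θ := by nlinarith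
  have hq : 16 * θ ≤ q := by nlinarith
  have h5 : q ^ 2 * (1 / 2 - 0) / (1 + q * (1 / 2 - 0)) ≤ 2 * ν + 2 * θ := by linarith
  rw [div_le_iff₀ (by linarith)] at h5
  nlinarith

end IsSelfConcordantBarrier

end Line

/-- The second derivative is even in the direction, so the Dikin step may also be taken backwards.
-/
lemma IsSelfConcordantBarrier.sub_smul_mem_of_mul_sqrt_lt_one {E : Type*} [NormedAddCommGroup E]
    [NormedSpace ℝ E] {S : Set E} {ν : ℝ} {F : E → ℝ} (hF : IsSelfConcordantBarrier S ν F)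
    {x h : E} (hx : x ∈ intrinsicInterior ℝ S) (hh : h ∈ vectorSpan ℝ S) {δ : ℝ} (hδ : 0 ≤ δ)
    (hq : δ * √(iteratedDeriv 2 (fun τ : ℝ => F (x + τ • h)) 0) < 1) :
    x - δ • h ∈ intrinsicInterior ℝ S := by
  have := hF.add_smul_mem_of_mul_sqrt_lt_one hx (Submodule.neg_mem _ hh) hδ ?_
  · simpa [sub_eq_add_neg] using this
  · have h1 := iteratedDeriv_comp_neg 2 (fun τ : ℝ => F (x + τ • h)) 0
    simp only [neg_smul, neg_zero, even_two, Even.neg_pow, one_pow, one_smul] at h1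
    simp only [smul_neg, h1]
    exact hq

/-- First-order optimality of a minimizer of `ℓ + F` over the relative interior, for `ℓ` affine
along the segment from the minimizer to `y`. -/
lemma deriv_eq_of_isMinOn {E : Type*} [NormedAddCommGroup E] [NormedSpace ℝ E] {S : Set E} {ν : ℝ}
    {F ℓ : E → ℝ} (hF : IsSelfConcordantBarrier S ν F) {x y : E}
    (hx : x ∈ intrinsicInterior ℝ S) (hy : y ∈ S)
    (hmin : IsMinOn (fun z => ℓ z + F z) (intrinsicInterior ℝ S) x)
    (hℓ : ∀ τ : ℝ, ℓ (x + τ • (y - x)) = ℓ x + τ * (ℓ y - ℓ x)) :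
    deriv (fun τ : ℝ => F (x + τ • (y - x))) 0 = -(ℓ y - ℓ x) := by
  have hxS := intrinsicInterior_subset hx
  have hh : y - x ∈ vectorSpan ℝ S := vsub_mem_vectorSpan ℝ hy hxS
  have h0 : (0 : ℝ) ∈ {τ : ℝ | x + τ • (y - x) ∈ intrinsicInterior ℝ S} := by simpa using hx
  have hd := (hF.isSelfConcordantOn (x := x) hh).hasDerivAt_zero h0
  have hd' := ((hasDerivAt_id (0 : ℝ)).mul_const (ℓ y - ℓ x)).const_add (ℓ x) |>.add hd
  have hloc : IsLocalMin ((fun τ : ℝ => ℓ x + id τ * (ℓ y - ℓ x)) +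
      fun τ : ℝ => F (x + τ • (y - x))) 0 := by
    -- Small steps of either sign remain in the relative interior, hence an equality and not just a
    -- one-sided inequality.
    filter_upwards [(isOpen_setOf_add_smul_mem_intrinsicInterior hxS hh).mem_nhds h0] with τ hτ
    have := isMinOn_iff.1 hmin _ hτ
    simpa [hℓ] using this
  have := hloc.hasDerivAt_eq_zero hd'
  linarith

/-! ### The modified program and its penalty. -/

section ModifiedProgram

variable {m d : ℕ} {A : Matrix (Fin m) (Fin d) ℝ} {b : Fin m → ℝ}
  {K : Set (EuclideanSpace ℝ (Fin d))} {c : EuclideanSpace ℝ (Fin d)} {s : ℝ}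

lemma convex_modifiedSet (hK : Convex ℝ K) : Convex ℝ (modifiedSet A b K) := by
  rintro x ⟨hx1, hx2, hx3, hx4⟩ y ⟨hy1, hy2, hy3, hy4⟩ α β hα hβ hαβ
  refine ⟨hK hx1 hy1 hα hβ hαβ, fun i => ?_, fun i => ?_, ?_⟩
  · have := mul_nonneg hα (hx2 i)
    have := mul_nonneg hβ (hy2 i)
    simp
    linarith
  · have := mul_nonneg hα (hx3 i)
    have := mul_nonneg hβ (hy3 i)
    simp
    linarith
  · have h1 : collapse (α • x + β • y) = α • collapse x + β • collapse y := by
      simp only [collapse, Prod.fst_add, Prod.smul_fst, Prod.snd_add, Prod.smul_snd]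
      module
    rw [h1, WithLp.ofLp_add, WithLp.ofLp_smul, WithLp.ofLp_smul, Matrix.mulVec_add,
      Matrix.mulVec_smul, Matrix.mulVec_smul, hx4, hy4, ← add_smul, hαβ, one_smul]

lemma modifiedCost_lineMap (x y : SlackSpace d) (τ : ℝ) :
    modifiedCost c s (x + τ • (y - x)) =
      modifiedCost c s x + τ * (modifiedCost c s y - modifiedCost c s x) := by
  simp only [modifiedCost, Prod.fst_add, Prod.snd_add, Prod.smul_fst, Prod.smul_snd, Prod.fst_sub,
    Prod.snd_sub, inner_add_right, inner_smul_right, inner_sub_right]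
  ring

lemma EuclideanSpace.norm_le_sum_of_nonneg {w : EuclideanSpace ℝ (Fin d)} (hw : ∀ i, 0 ≤ w i) :
    ‖w‖ ≤ ∑ i, w i := by
  refine le_of_sq_le_sq ?_ (Finset.sum_nonneg fun i _ => hw i)
  rw [EuclideanSpace.real_norm_sq_eq]
  exact Finset.sum_sq_le_sq_sum_of_nonneg fun i _ => hw i

/-- On nonnegative vectors the penalty is a multiple of the 1-norm, which dominates the 2-norm. -/
lemma mul_norm_le_inner_penaltyVector (hs : 0 ≤ s) {w : EuclideanSpace ℝ (Fin d)}
    (hw : ∀ i, 0 ≤ w i) : s * ‖c‖ / √(d : ℝ) * ‖w‖ ≤ inner ℝ (penaltyVector c s) w := by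
  have h1 : inner ℝ (penaltyVector c s) w = s * ‖c‖ / √(d : ℝ) * ∑ i, w i := by
    rw [Finset.mul_sum, PiLp.inner_apply]
    exact Finset.sum_congr rfl fun i _ => by simp [penaltyVector, mul_comm]
  rw [h1]
  have := EuclideanSpace.norm_le_sum_of_nonneg hw
  gcongr

lemma mul_norm_slack_le (hs : 0 ≤ s) {x : SlackSpace d} (hx : x ∈ modifiedSet A b K) :
    s * ‖c‖ / √(d : ℝ) * ‖x.2.1 - x.2.2‖ ≤ modifiedCost c s x - inner ℝ c x.1 := by
  have h1 := mul_norm_le_inner_penaltyVector (c := c) hs hx.2.1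
  have h2 := mul_norm_le_inner_penaltyVector (c := c) hs hx.2.2.1
  have h3 : s * ‖c‖ / √(d : ℝ) * ‖x.2.1 - x.2.2‖ ≤
      s * ‖c‖ / √(d : ℝ) * (‖x.2.1‖ + ‖x.2.2‖) := by
    gcongr
    exact norm_sub_le _ _
  simp only [modifiedCost]
  linarith

lemma abs_inner_le_of_norm_le {R : ℝ} (hR : ∀ x ∈ K, ‖x‖ ≤ R) {x : EuclideanSpace ℝ (Fin d)}
    (hx : x ∈ K) : |inner ℝ c x| ≤ ‖c‖ * R :=
  (abs_real_inner_le_norm c x).trans (by gcongr; exact hR x hx)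

lemma prod_zero_mem_modifiedSet {x : EuclideanSpace ℝ (Fin d)} (hx : x ∈ feasibleSet A b K) :
    ((x, 0, 0) : SlackSpace d) ∈ modifiedSet A b K :=
  ⟨hx.1, fun i => by simp, fun i => by simp, by simpa [collapse] using hx.2⟩

lemma modifiedCost_prod_zero (x : EuclideanSpace ℝ (Fin d)) :
    modifiedCost c s (x, 0, 0) = inner ℝ c x := by
  simp [modifiedCost]

lemma sInf_modifiedCost_le {R : ℝ} (hs : 0 ≤ s) (hR : ∀ x ∈ K, ‖x‖ ≤ R)
    (hne : (feasibleSet A b K).Nonempty) :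
    sInf (modifiedCost c s '' modifiedSet A b K) ≤
      sInf ((fun x => inner ℝ c x) '' feasibleSet A b K) := by
  refine le_csInf (hne.image _) ?_
  rintro _ ⟨x, hx, rfl⟩
  refine csInf_le ⟨-(‖c‖ * R), ?_⟩ ⟨_, prod_zero_mem_modifiedSet hx, modifiedCost_prod_zero x⟩
  rintro _ ⟨y, hy, rfl⟩
  have h1 := mul_norm_slack_le (c := c) hs hy
  have h2 := (abs_le.1 (abs_inner_le_of_norm_le (c := c) hR hy.1)).1
  have h3 : 0 ≤ s * ‖c‖ / √(d : ℝ) * ‖y.2.1 - y.2.2‖ := by positivity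
  linarith

/-- A barrier for the modified program has parameter at least one, as `x⁽²⁾` and `x⁽³⁾` can only be
decreased finitely far. -/
lemma one_le_param_of_modifiedSet [NeZero d] {ν : ℝ} {ψ : SlackSpace d → ℝ}
    (hψ : IsSelfConcordantBarrier (modifiedSet A b K) ν ψ) {x : SlackSpace d}
    (hx : x ∈ intrinsicInterior ℝ (modifiedSet A b K)) : 1 ≤ ν := by
  have hxS := intrinsicInterior_subset hx
  let e : EuclideanSpace ℝ (Fin d) := WithLp.toLp 2 fun _ => 1
  have hy : x + ((0, e, e) : SlackSpace d) ∈ modifiedSet A b K := by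
    refine ⟨by simpa using hxS.1, fun i => ?_, fun i => ?_, ?_⟩
    · simpa [e] using add_nonneg (hxS.2.1 i) zero_le_one
    · simpa [e] using add_nonneg (hxS.2.2.1 i) zero_le_one
    · have : collapse (x + ((0, e, e) : SlackSpace d)) = collapse x := by
        simp [collapse]
        abel
      rw [this]
      exact hxS.2.2.2
  have hh := vsub_mem_vectorSpan ℝ hxS hy
  -- The direction is `-(0, e, e)`, which preserves `collapse`; at this time coordinate `0` of
  -- `x⁽²⁾` equals `-1`.
  refine hψ.one_le_param hx hh (τ₁ := x.2.1 0 + 1) (by linarith [hxS.2.1 0]) fun hout => ?_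
  have := (intrinsicInterior_subset hout).2.1 0
  simp [e] at this
  linarith

end ModifiedProgram

/-! ### Geometry of the inner ball and the main theorem. -/

lemma radius_le_two_mul_of_ball_subset {E : Type*} [NormedAddCommGroup E] [NormedSpace ℝ E]
    [Nontrivial E] {K : Set E} {z : E} {r R : ℝ} (hr : 0 < r) (hball : Metric.ball z r ⊆ K)
    (hR : ∀ x ∈ K, ‖x‖ ≤ R) : r ≤ 2 * R := by
  obtain ⟨v, hv⟩ := exists_norm_eq E (show 0 ≤ r / 2 by positivity)
  have h1 := hR _ (hball (show z + v ∈ Metric.ball z r by simp [hv]; linarith))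
  have h2 := hR _ (hball (show z - v ∈ Metric.ball z r by simp [hv]; linarith))
  have h3 : ‖(2 : ℝ) • v‖ ≤ ‖z + v‖ + ‖z - v‖ := by
    rw [show (2 : ℝ) • v = (z + v) - (z - v) by module]
    exact norm_sub_le _ _
  rw [norm_smul, hv] at h3
  norm_num at h3
  linarith

/-- The point `x + u` is the average of `x - δ(z - u - x)` and `z + u/δ` with weights `1/(1+δ)` and
`δ/(1+δ)`. -/
lemma Convex.add_mem_of_sub_smul_mem {E : Type*} [NormedAddCommGroup E] [NormedSpace ℝ E]
    {K : Set E} (hK : Convex ℝ K) {x z u : E} {r δ : ℝ} (hball : Metric.ball z r ⊆ K)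
    (hδ : 0 < δ) (hu : δ⁻¹ * ‖u‖ < r) (hx : x - δ • (z - u - x) ∈ K) : x + u ∈ K := by
  have hw : z + δ⁻¹ • u ∈ K := hball (by
    rw [mem_ball_iff_norm, add_sub_cancel_left, norm_smul, Real.norm_of_nonneg (by positivity)]
    exact hu)
  have h1 : 0 < 1 + δ := by positivity
  have := hK hx hw (inv_nonneg.2 h1.le) (show 0 ≤ (1 + δ)⁻¹ * δ by positivity) (by field_simp)
  convert this using 1
  rw [mul_smul, ← smul_add, eq_inv_smul_iff₀ h1.ne', smul_add δ, smul_inv_smul₀ hδ.ne']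
  module

theorem mainTheorem6 {m d : ℕ} (A : Matrix (Fin m) (Fin d) ℝ) (b : Fin m → ℝ)
    (c : EuclideanSpace ℝ (Fin d)) (hc : c ≠ 0)
    (K Kin : Set (EuclideanSpace ℝ (Fin d))) (hK : Convex ℝ K) (hKin : Convex ℝ Kin)
    (hsub : Kin ⊆ K)
    (R r : ℝ) (hR : ∀ x ∈ K, ‖x‖ ≤ R)
    (hr : 0 < r) (hinner : ∃ z, A *ᵥ z.ofLp = b ∧ Metric.ball z r ⊆ Kin)
    (ν t s γ : ℝ) (ht : 0 < t) (htν : ν / (‖c‖ * R) < t)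
    (hs : 0 < s) (hsbig : 48 * ν * t * √(d : ℝ) * (R / r) * (‖c‖ * R) ≤ s)
    (ψ : SlackSpace d → ℝ) (hψ : IsSelfConcordantBarrier (modifiedSet A b Kin) ν ψ)
    (xt : SlackSpace d) (hxt : xt ∈ intrinsicInterior ℝ (modifiedSet A b Kin))
    (hmin : IsMinOn (fun x => t * modifiedCost c s x + ψ x)
      (intrinsicInterior ℝ (modifiedSet A b Kin)) xt)
    (hγ : sInf (modifiedCost c s '' modifiedSet A b Kin) ≤
      sInf (modifiedCost c s '' modifiedSet A b K) + γ) :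
    A *ᵥ (collapse xt).ofLp = b ∧
    collapse xt ∈ Kin ∧
    inner ℝ c (collapse xt) ≤
      sInf ((fun x => inner ℝ c x) '' feasibleSet A b K) + (ν + 1) / t + γ := by
  obtain ⟨z, hz, hball⟩ := hinner
  have hxS := intrinsicInterior_subset hxt
  have : Nontrivial (EuclideanSpace ℝ (Fin d)) := nontrivial_of_ne c 0 hc
  have hd : d ≠ 0 := by
    rintro rfl
    exact hc (Subsingleton.elim _ _)
  have : NeZero d := ⟨hd⟩
  have hd0 : 0 < √(d : ℝ) := Real.sqrt_pos.2 (by exact_mod_cast Nat.pos_of_ne_zero hd)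
  have hRr := radius_le_two_mul_of_ball_subset hr (hball.trans hsub) hR
  have hR0 : 0 < R := by linarith
  have hc0 : 0 < ‖c‖ := norm_pos_iff.2 hc
  have hν := one_le_param_of_modifiedSet hψ hxt
  have hconv := convex_modifiedSet (A := A) (b := b) hKin
  have hRin : ∀ x ∈ Kin, ‖x‖ ≤ R := fun x hx => hR x (hsub hx)
  have hzKin : z ∈ Kin := hball (Metric.mem_ball_self hr)
  set θ := t * (‖c‖ * R) with hθdef
  have hθ : ν < θ := (div_lt_iff₀ (by positivity)).1 htν
  have hslope : ∀ y ∈ modifiedSet A b Kin,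
      deriv (fun τ : ℝ => ψ (xt + τ • (y - xt))) 0 =
        -(t * modifiedCost c s y - t * modifiedCost c s xt) := fun y hy =>
    deriv_eq_of_isMinOn (ℓ := fun x => t * modifiedCost c s x) hψ hxt hy hmin fun τ => by
      rw [modifiedCost_lineMap]
      ring
  have hopt : ∀ y ∈ modifiedSet A b Kin, modifiedCost c s xt ≤ modifiedCost c s y + ν / t := by
    intro y hy
    have h1 := hψ.deriv_mul_le hconv (by linarith) hxt hy le_rfl one_pos
    rw [hslope y hy] at h1
    rw [← sub_le_iff_le_add', le_div_iff₀ ht]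
    linarith
  set u := xt.2.1 - xt.2.2 with hu
  have hcol : collapse xt = xt.1 + u := by
    rw [hu, ← add_sub_assoc]
    rfl
  have hslack : s * ‖c‖ / √(d : ℝ) * ‖u‖ ≤ _ := mul_norm_slack_le (c := c) hs.le hxS
  have hpen : 48 * ν * θ * (R / r) * ‖c‖ ≤ s * ‖c‖ / √(d : ℝ) := by
    rw [le_div_iff₀ hd0]
    calc 48 * ν * θ * (R / r) * ‖c‖ * √(d : ℝ)
        = 48 * ν * t * √(d : ℝ) * (R / r) * (‖c‖ * R) * ‖c‖ := by rw [hθdef]; ring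
      _ ≤ s * ‖c‖ := by gcongr
  have hνθ : 1 ≤ ν * θ := by nlinarith
  have hRr' : 1 / 2 ≤ R / r := by
    rw [le_div_iff₀ hr]
    linarith
  -- Here `48 = 3 · 16`: the penalty paid is at most `cᵀz - cᵀx⁽¹⁾ + ν/t`, and each of the three
  -- terms is at most `‖c‖R`.
  have hunorm : ‖u‖ * (16 * ν * θ) ≤ r := by
    have h1 := hopt _ (prod_zero_mem_modifiedSet ⟨hzKin, hz⟩)
    rw [modifiedCost_prod_zero] at h1
    have h2 := (abs_le.1 (abs_inner_le_of_norm_le (c := c) hRin hzKin)).2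
    have h3 := (abs_le.1 (abs_inner_le_of_norm_le (c := c) hRin hxS.1)).1
    have h4 : ν / t ≤ ‖c‖ * R := by
      rw [div_le_iff₀ ht]
      linarith
    have h5 : 48 * ν * θ * (R / r) * ‖c‖ * ‖u‖ ≤ 3 * (‖c‖ * R) :=
      (mul_le_mul_of_nonneg_right hpen (norm_nonneg u)).trans (by linarith)
    have h6 : 48 * ν * θ * (R / r) * ‖c‖ * ‖u‖ =
        3 * (‖c‖ * R) * (‖u‖ * (16 * ν * θ) / r) := by
      field_simp
      ring
    rw [h6] at h5
    have h7 := le_of_mul_le_mul_left (h5.trans_eq (mul_one _).symm) (by positivity)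
    rwa [div_le_one hr] at h7
  refine ⟨hxS.2.2.2, ?_, ?_⟩
  · have hur : ‖u‖ < r := by nlinarith [norm_nonneg u]
    have hzu : z - u ∈ Kin := hball (by simpa [mem_ball_iff_norm] using hur)
    -- Keeping the slack blocks of `xt` cancels the penalties in the slope, leaving a cost
    -- difference of at most `2‖c‖R`.
    have hy : ((z - u, xt.2.1, xt.2.2) : SlackSpace d) ∈ modifiedSet A b Kin := by
      refine ⟨hzu, hxS.2.1, hxS.2.2.1, ?_⟩
      rw [show collapse ((z - u, xt.2.1, xt.2.2) : SlackSpace d) = z by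
        simp only [collapse, hu]
        abel]
      exact hz
    have hq := hψ.sqrt_hessian_lt hconv hν hxt hy hθ (by
      rw [hslope _ hy]
      have h1 := (abs_le.1 (abs_inner_le_of_norm_le (c := c) hRin hzu)).2
      have h2 := (abs_le.1 (abs_inner_le_of_norm_le (c := c) hRin hxS.1)).1
      have h3 : inner ℝ c (z - u) - inner ℝ c xt.1 ≤ 2 * (‖c‖ * R) := by linarith
      have h4 := mul_le_mul_of_nonneg_left h3 ht.le
      simp only [modifiedCost]
      linarith)
    set q := √(iteratedDeriv 2 (fun τ : ℝ => ψ (xt + τ • ((z - u, xt.2.1, xt.2.2) - xt))) 0)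
    have hq0 : 0 ≤ q := Real.sqrt_nonneg _
    -- With `δ = 1/M`, both the Dikin condition `q/M < 1` and, when `u ≠ 0`, `M‖u‖ < r` are strict.
    obtain ⟨M, hqM, hM⟩ := exists_between hq
    have hM0 : 0 < M := hq0.trans_lt hqM
    have hmem := intrinsicInterior_subset (hψ.sub_smul_mem_of_mul_sqrt_lt_one hxt
      (vsub_mem_vectorSpan ℝ hy hxS) (inv_nonneg.2 hM0.le) (by
        rw [inv_mul_lt_iff₀ hM0, mul_one]
        exact hqM))
    rw [hcol]
    refine hKin.add_mem_of_sub_smul_mem hball (inv_pos.2 hM0) ?_ hmem.1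
    rw [inv_inv]
    rcases (norm_nonneg u).eq_or_lt with h0 | h0
    · rw [← h0]
      simpa using hr
    · nlinarith
  · have h1 : ‖c‖ ≤ s * ‖c‖ / √(d : ℝ) := by
      refine le_trans ?_ hpen
      have : 1 ≤ 48 * ν * θ * (R / r) := by nlinarith
      nlinarith
    have h2 : inner ℝ c u ≤ s * ‖c‖ / √(d : ℝ) * ‖u‖ :=
      (real_inner_le_norm c u).trans (by gcongr)
    have h3 : inner ℝ c (collapse xt) ≤ modifiedCost c s xt := by
      rw [hcol, inner_add_right]
      linarith
    have h4 : modifiedCost c s xt - ν / t ≤ sInf (modifiedCost c s '' modifiedSet A b Kin) := by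
      refine le_csInf ⟨_, xt, hxS, rfl⟩ ?_
      rintro _ ⟨y, hy, rfl⟩
      linarith [hopt y hy]
    have h5 := sInf_modifiedCost_le (A := A) (b := b) (c := c) hs.le hR ⟨z, hsub hzKin, hz⟩
    -- The chain of bounds already gives `ν / t`; the extra `1 / t` is slack.
    have h6 : 0 < 1 / t := by positivity
    rw [add_div]
    linarith
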